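/- Let $R$ be a commutative Noetherian ring of finite Krull dimension. For a Noetherian module $M$ over a commutative ring, the (ordinal) length $\mathrm{len}(M)$ is the supremum of the order types of the chains of non-zero submodules of $M$, ordered by reverse inclusion; the finitistic length of $M$ is the supremum of all $\mathrm{len}(N)$, where $N$ runs over the submodules of $M$ with $\mathrm{len}(N)<\omega$. The fundamental cycle of a finitely generated $R$-module $M$ is the formal sum $\sum_{\mathfrak p} \ell_{\mathfrak p}(M)\,[\mathfrak p]$ over the prime ideals $\mathfrak p$ of $R$, where $\ell_{\mathfrak p}(M)$ is the finitistic length of the $R_{\mathfrak p}$-module $M_{\mathfrak p}$. The module $M$ is called binary if its fundamental cycle is a finite sum $\sum_{\mathfrak p\in S}[\mathfrak p]$ of distinct primes. A submodule $N\subseteq M$ is called open if $\mathrm{len}(N)=\mathrm{len}(M)$. Let $M$ be a finitely generated binary $R$-module without embedded primes, that is, every associated prime of $M$ is minimal among the associated primes of $M$. Then $M$ is topologically compressible: for every open submodule $N\subseteq M$ there is an injective $R$-linear map $M\to N$. -/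

import Mathlib

universe u v

noncomputable section

namespace OrdinalLength

/-- The ordinals that occur as order types of chains of non-zero submodules of `M`, ordered by
reverse inclusion: a chain of type `α` is listed by the ordinals below `α`, in strictly
decreasing order. -/
def chainTypes (R : Type u) (M : Type v) [CommRing R] [AddCommGroup M] [Module R M] :
    Set Ordinal.{v} :=
  {α | ∃ f : Set.Iio α → Submodule R M, StrictAnti f ∧ ∀ i, f i ≠ ⊥}

/-- The supremum in the definition of the length is a genuine one. -/
theorem bddAbove_chainTypes (R : Type u) (M : Type v) [CommRing R] [AddCommGroup M]
    [Module R M] : BddAbove (chainTypes R M) := by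
  refine ⟨(Order.succ (Cardinal.mk (Submodule R M))).ord, ?_⟩
  rintro α ⟨f, hf, -⟩
  have h := Cardinal.lift_mk_le_lift_mk_of_injective hf.injective
  rw [Cardinal.mk_Iio_ordinal, Cardinal.lift_lift, Cardinal.lift_le] at h
  exact (Cardinal.lt_ord.mpr (Order.lt_succ_of_le h)).le

/-- The ordinal length of `M`: the supremum of the order types of the descending chains of
submodules of `M`. Only non-zero submodules are counted in a chain, so that on modules of finite
length this is the usual length. -/
def len (R : Type u) (M : Type v) [CommRing R] [AddCommGroup M] [Module R M] : Ordinal.{v} :=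
  sSup (chainTypes R M)

/-- The finitistic length of `M`: the supremum of the lengths of those submodules of `M` that
have finite length. -/
def finLen (R : Type u) (M : Type v) [CommRing R] [AddCommGroup M] [Module R M] : Ordinal.{v} :=
  sSup {α | ∃ N : Submodule R M, len R N = α ∧ α < Ordinal.omega0}

/-- The fundamental cycle of `M`, given by its coefficients: the coefficient at the prime `p` is
the finitistic length of the localization of `M` at `p`, over the localized ring. -/
def fundamentalCycle (R : Type u) (M : Type v) [CommRing R] [AddCommGroup M] [Module R M] :
    PrimeSpectrum R → Ordinal.{max u v} :=
  fun p => finLen (Localization.AtPrime p.asIdeal) (LocalizedModule p.asIdeal.primeCompl M)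

/-- `M` is binary: its fundamental cycle is a (finite) sum of distinct primes. -/
def IsBinary (R : Type u) (M : Type v) [CommRing R] [AddCommGroup M] [Module R M] : Prop :=
  ∃ S : Finset (PrimeSpectrum R),
    fundamentalCycle R M = Set.indicator (S : Set (PrimeSpectrum R)) 1

/-- `p` is an embedded prime of `M`: an associated prime of `M` that is not minimal among the
associated primes of `M`. -/
def IsEmbeddedPrime (R : Type u) (M : Type v) [CommRing R] [AddCommGroup M] [Module R M]
    (p : Ideal R) : Prop :=
  p ∈ associatedPrimes R M ∧ ¬ Minimal (· ∈ associatedPrimes R M) p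

/-- A submodule of `M` is open if it has the same ordinal length as `M`. -/
def IsOpenSubmodule {R : Type u} {M : Type v} [CommRing R] [AddCommGroup M] [Module R M]
    (N : Submodule R M) : Prop :=
  len R N = len R M

/-- `M` is topologically compressible if it embeds in each of its open submodules. -/
def IsTopCompressible (R : Type u) (M : Type v) [CommRing R] [AddCommGroup M] [Module R M] :
    Prop :=
  ∀ N : Submodule R M, IsOpenSubmodule N → ∃ f : M →ₗ[R] N, Function.Injective f

end OrdinalLength

end

/-! Without embedded primes, `M_p` has finite length at each associated prime `p`, so binarity makes
that length at most 1. Clearing denominators then gives `f_p : M → R/p` whose kernel is the set of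
elements vanishing at `p`; jointly the `f_p` are injective. As the associated primes are
incomparable, a submodule `N` on which no `f_p` vanishes contains elements `n_p` with `f_q (n_p) ≠
0` exactly when `q = p`, and `m ↦ ∑ f_p(m) n_p` embeds `M` in `N`.

An open `N` is of this kind. If `f_p` vanished on `N`, the other coordinates would bound `len N` by
the natural sum of `ω ^ dim R/q` over `q ≠ p` (`lenLE_of_separating`), whereas `M` has a chain whose
type is the sum over all `q` (`hasChain_span_of_dual`). Both bounds rest on `R/q` having length `ω ^
dim R/q`. Chain types are compared as formal sums, through a strictly monotone map to the ordinals,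
so no ordinal arithmetic is needed. -/

namespace OrdinalLength

/-! ### Values: formal sums of powers of `ω` -/

/-- Finite formal sums of powers of `ω` with natural coefficients, under the natural (Hessenberg)
addition: `single d 1` stands for `ω ^ d`. -/
abbrev Value : Type := Colex (ℕ →₀ ℕ)

/-- The value standing for `ω ^ d`. -/
noncomputable def omegaPow (d : ℕ) : Value := toColex (Finsupp.single d 1)

theorem lt_omegaPow_iff {c : Value} {d : ℕ} : c < omegaPow d ↔ ∀ i, d ≤ i → ofColex c i = 0 := by
  constructor
  · rintro ⟨j, hj, hlt⟩ i hi
    have hjd : j = d := by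
      by_contra h
      simp [omegaPow, Ne.symm h] at hlt
    subst hjd
    rcases hi.eq_or_lt with rfl | hi
    · simpa [omegaPow] using hlt
    · have := hj i hi
      simpa [omegaPow, Finsupp.single_apply, hi.ne] using this
  · intro h
    refine ⟨d, fun i hi => ?_, ?_⟩
    · have := h i (le_of_lt hi)
      simpa [omegaPow, Finsupp.single_apply, (ne_of_lt hi)] using this
    · have := h d le_rfl
      simp [omegaPow, this]

theorem omegaPow_strictMono : StrictMono omegaPow := Finsupp.Colex.single_strictMono

theorem add_lt_omegaPow {a b : Value} {d : ℕ} (ha : a < omegaPow d) (hb : b < omegaPow d) :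
    a + b < omegaPow d := by
  rw [lt_omegaPow_iff] at *
  intro i hi
  have h1 := ha i hi
  have h2 := hb i hi
  simp [h1, h2]

theorem sum_lt_omegaPow {ι : Type*} (s : Finset ι) (f : ι → Value) {d : ℕ}
    (h : ∀ i ∈ s, f i < omegaPow d) : ∑ i ∈ s, f i < omegaPow d := by
  refine Finset.sum_induction f (· < omegaPow d) (fun a b => add_lt_omegaPow) ?_ h
  rw [lt_omegaPow_iff]
  exact fun i _ => rfl

theorem lt_omegaPow_zero_iff {c : Value} : c < omegaPow 0 ↔ c = 0 := by
  rw [lt_omegaPow_iff]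
  constructor
  · intro h
    exact ofColex.injective (Finsupp.ext fun i => h i (Nat.zero_le i))
  · rintro rfl i -
    rfl

theorem omegaPow_pos (d : ℕ) : 0 < omegaPow d := by
  rw [lt_omegaPow_iff]
  exact fun i _ => rfl

theorem value_nonneg (c : Value) : 0 ≤ c := bot_le

theorem exists_eq_nsmul_add {c : Value} {d : ℕ} (h : c < omegaPow (d + 1)) :
    ∃ (n : ℕ) (r : Value), r < omegaPow d ∧ c = n • omegaPow d + r := by
  rw [lt_omegaPow_iff] at h
  refine ⟨ofColex c d, toColex ((ofColex c).erase d), ?_, ?_⟩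
  · rw [lt_omegaPow_iff]
    intro i hi
    rcases hi.eq_or_lt with rfl | hi
    · simp
    · have := h i hi
      simp [Finsupp.erase_apply, this]
  · refine ofColex.injective (Finsupp.ext fun i => ?_)
    change ofColex c i = ofColex c d * Finsupp.single d 1 i + (ofColex c).erase d i
    rcases eq_or_ne i d with rfl | hi
    · simp
    · simp [hi]

theorem nsmul_add_lt_nsmul_add {m n : ℕ} {r s : Value} {d : ℕ} (hr : r < omegaPow d)
    (h : m < n) : m • omegaPow d + r < n • omegaPow d + s :=
  calc m • omegaPow d + r < m • omegaPow d + omegaPow d := by gcongr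
    _ = (m + 1) • omegaPow d := (succ_nsmul _ _).symm
    _ ≤ n • omegaPow d := nsmul_le_nsmul_left (value_nonneg _) h
    _ ≤ n • omegaPow d + s := le_add_of_nonneg_right (value_nonneg _)

theorem lex_of_nsmul_add_lt {m n : ℕ} {r s : Value} {d : ℕ} (hs : s < omegaPow d)
    (h : m • omegaPow d + r < n • omegaPow d + s) : m < n ∨ m = n ∧ r < s := by
  rcases lt_trichotomy m n with hmn | rfl | hmn
  · exact Or.inl hmn
  · exact Or.inr ⟨rfl, lt_of_add_lt_add_left h⟩
  · exact absurd h (nsmul_add_lt_nsmul_add hs hmn).not_gt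

theorem exists_eq_omegaPow_add {c : Value} {d : ℕ} (h : c < omegaPow (d + 1))
    (hd : omegaPow d ≤ c) : ∃ r, c = omegaPow d + r := by
  obtain ⟨n, r, hr, rfl⟩ := exists_eq_nsmul_add h
  cases n with
  | zero => simp [hr.not_ge] at hd
  | succ n => exact ⟨n • omegaPow d + r, by rw [succ_nsmul', add_assoc]⟩

/-- The ordinal a value stands for. -/
noncomputable def Value.toOrdinal (c : Value) : Ordinal.{v} :=
  Ordinal.lift.{v} (IsWellFounded.rank (· < ·) c)

theorem Value.toOrdinal_strictMono : StrictMono Value.toOrdinal.{v} := fun _ _ h =>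
  Ordinal.lift_lt.mpr (WellFoundedLT.rank_strictMono h)

theorem Value.exists_toOrdinal_eq {c : Value} {o : Ordinal.{v}} (h : o < c.toOrdinal) :
    ∃ x < c, x.toOrdinal = o := by
  obtain ⟨o', rfl⟩ := Ordinal.mem_range_lift_of_le h.le
  rw [Value.toOrdinal, Ordinal.lift_lt] at h
  obtain ⟨x, rfl⟩ := IsWellFounded.mem_range_rank_of_le h.le
  refine ⟨x, ?_, rfl⟩
  exact WellFoundedLT.rank_strictMono.lt_iff_lt.mp h

theorem Value.toOrdinal_lt_omega0 {c : Value} (h : c < omegaPow 1) :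
    c.toOrdinal < Ordinal.omega0.{v} := by
  obtain ⟨n, r, hr, rfl⟩ := exists_eq_nsmul_add h
  obtain rfl := lt_omegaPow_zero_iff.mp hr
  rw [add_zero] at h ⊢
  clear hr
  -- An upper bound is enough: any smaller ordinal comes from some `k • omegaPow 0` with `k < n`.
  suffices H : (n • omegaPow 0).toOrdinal ≤ (n : Ordinal.{v}) from
    H.trans_lt (Ordinal.natCast_lt_omega0 n)
  induction n using Nat.strong_induction_on with
  | _ n ih =>
    refine le_of_forall_lt fun o ho => ?_
    obtain ⟨x, hx, rfl⟩ := Value.exists_toOrdinal_eq ho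
    obtain ⟨k, s, hs, rfl⟩ := exists_eq_nsmul_add (hx.trans h)
    obtain rfl := lt_omegaPow_zero_iff.mp hs
    rw [add_zero] at hx ⊢
    have hk : k < n := by
      by_contra hk
      exact hx.not_ge (nsmul_le_nsmul_left (value_nonneg _) (not_lt.mp hk))
    exact (ih k hk (hx.trans h)).trans_lt (by exact_mod_cast hk)

/-! ### Upper bounds for descending chains -/

section RankLE

variable {P Q : Type*}

/-- `RankLE x c` says that the descending chains of elements above `x` have type at most `c`. -/
inductive RankLE [Preorder P] : P → Value → Prop
  | intro (x : P) (c : Value) (f : ∀ y, x < y → Value) (hlt : ∀ y (h : x < y), f y h < c)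
      (hrank : ∀ y (h : x < y), RankLE y (f y h)) : RankLE x c

theorem rankLE_iff [Preorder P] {x : P} {c : Value} :
    RankLE x c ↔ ∀ y, x < y → ∃ c' < c, RankLE y c' := by
  constructor
  · intro h y hy
    obtain ⟨_, _, f, hlt, hrank⟩ := h
    exact ⟨f y hy, hlt y hy, hrank y hy⟩
  · intro h
    choose f hlt hrank using h
    exact .intro x c f hlt hrank

theorem RankLE.mono [Preorder P] {x : P} {c c' : Value} (h : RankLE x c) (hc : c ≤ c') :
    RankLE x c' := by
  rw [rankLE_iff] at *
  intro y hy
  obtain ⟨d, hd, h⟩ := h y hy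
  exact ⟨d, hd.trans_le hc, h⟩

theorem RankLE.comap [Preorder P] [Preorder Q] (φ : P → Q) {x : P} {c : Value}
    (hφ : StrictMonoOn φ (Set.Ici x)) (h : RankLE (φ x) c) : RankLE x c := by
  generalize hz : φ x = z at h
  induction h generalizing x with
  | intro z c f hlt hrank ih =>
    subst hz
    rw [rankLE_iff]
    intro y hy
    have hφy := hφ (Set.mem_Ici.mpr le_rfl) (Set.mem_Ici.mpr hy.le) hy
    exact ⟨_, hlt _ hφy, ih _ hφy (hφ.mono (Set.Ici_subset_Ici.mpr hy.le)) rfl⟩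

/-- A strict step in the product is strict in some coordinate, and natural addition is strictly
monotone in each argument. -/
theorem RankLE.prod [PartialOrder P] [PartialOrder Q] {x : P} {y : Q} {a b : Value}
    (hx : RankLE x a) (hy : RankLE y b) : RankLE (x, y) (a + b) := by
  induction hx generalizing y b with
  | intro x a f hlt hrank ihx =>
    induction hy with
    | intro y b g hglt hgrank ihy =>
      rw [rankLE_iff]
      rintro ⟨x', y'⟩ h
      have h1 : x ≤ x' := h.le.1
      have h2 : y ≤ y' := h.le.2
      rcases h1.eq_or_lt with rfl | h1
      · have h2 : y < y' := lt_of_le_of_ne h2 (by rintro rfl; exact h.ne rfl)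
        exact ⟨_, by gcongr; exact hglt y' h2, ihy y' h2⟩
      · have hb : RankLE y' b := by
          rcases h2.eq_or_lt with rfl | h2
          · exact .intro _ _ g hglt hgrank
          · exact (hgrank y' h2).mono (hglt y' h2).le
        exact ⟨_, by gcongr; exact hlt x' h1, ihx x' h1 hb⟩

/-- The entries listed before position `o` all lie above the entry at `o`, whose bound is smaller;
hence induction. -/
theorem RankLE.le_toOrdinal [Preorder P] {x : P} {c : Value} (h : RankLE x c) {α : Ordinal.{v}}
    (f : Set.Iio α → P) (hf : StrictAnti f) (hx : ∀ i, x < f i) : α ≤ c.toOrdinal := by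
  induction h generalizing α with
  | intro x c g hlt hrank ih =>
    refine le_of_forall_lt fun o ho => ?_
    refine (ih _ (hx ⟨o, ho⟩) (α := o) (fun i => f ⟨i, i.2.trans ho⟩) ?_ ?_).trans_lt
      (Value.toOrdinal_strictMono (hlt _ (hx ⟨o, ho⟩)))
    · exact fun i j hij => hf hij
    · exact fun i => hf i.2

end RankLE

/-! ### Descending chains indexed by values -/

section HasChain

variable {P Q : Type*}

/-- `HasChain a b c` says that there is a descending chain of type `c` of elements `x` with
`a < x ≤ b`. -/
def HasChain [Preorder P] (a b : P) (c : Value) : Prop :=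
  ∃ f : Value → P, StrictAntiOn f (Set.Iio c) ∧ ∀ x < c, a < f x ∧ f x ≤ b

theorem hasChain_zero [Preorder P] (a b : P) : HasChain a b 0 :=
  ⟨fun _ => a, fun _ h => absurd h (value_nonneg _).not_gt, fun _ h =>
    absurd h (value_nonneg _).not_gt⟩

theorem hasChain_omegaPow_zero [Preorder P] {a b : P} (h : a < b) :
    HasChain a b (omegaPow 0) := by
  refine ⟨fun _ => b, fun x hx y hy hxy => ?_, fun _ _ => ⟨h, le_rfl⟩⟩
  rw [Set.mem_Iio, lt_omegaPow_zero_iff] at hx hy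
  exact absurd hxy (by simp [hx, hy])

theorem HasChain.map [PartialOrder P] [Preorder Q] {a b : P} {c : Value} (h : HasChain a b c)
    (φ : P → Q) (hφ : StrictMonoOn φ (Set.Icc a b)) : HasChain (φ a) (φ b) c := by
  obtain ⟨f, hf, hab⟩ := h
  have hmem : ∀ x < c, f x ∈ Set.Icc a b := fun x hx => ⟨(hab x hx).1.le, (hab x hx).2⟩
  refine ⟨φ ∘ f, fun x hx y hy hxy => hφ (hmem y hy) (hmem x hx) (hf hx hy hxy), fun x hx => ?_⟩
  have hle : a ≤ b := (hmem x hx).1.trans (hmem x hx).2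
  exact ⟨hφ ⟨le_rfl, hle⟩ (hmem x hx) (hab x hx).1,
    hφ.monotoneOn (hmem x hx) ⟨hle, le_rfl⟩ (hab x hx).2⟩

/-- The upper chain is listed first. The bound on `t` makes the natural sum `ω ^ d + t` agree with
concatenation: nothing of `t` precedes `ω ^ d`. -/
theorem HasChain.trans [Preorder P] {a b b' : P} {t : Value} {d : ℕ}
    (h : HasChain b b' (omegaPow d)) (h' : HasChain a b t) (hab : a ≤ b) (hb : b ≤ b')
    (ht : t < omegaPow (d + 1)) : HasChain a b' (omegaPow d + t) := by
  classical
  obtain ⟨f, hf, hfb⟩ := h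
  obtain ⟨g, hg, hgb⟩ := h'
  have key : ∀ x < omegaPow d + t, ¬ x < omegaPow d → ∃ r < t, x = omegaPow d + r := by
    intro x hx hxd
    obtain ⟨r, rfl⟩ := exists_eq_omegaPow_add
      (hx.trans (add_lt_omegaPow (omegaPow_strictMono d.lt_succ_self) ht)) (not_lt.mp hxd)
    exact ⟨r, lt_of_add_lt_add_left hx, rfl⟩
  -- Left subtraction of `ω ^ d`; the default 0 is never reached.
  let s : Value → Value := fun x => if h : ∃ r, x = omegaPow d + r then h.choose else 0
  have hs : ∀ r, s (omegaPow d + r) = r := by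
    intro r
    have h : ∃ r', omegaPow d + r = omegaPow d + r' := ⟨r, rfl⟩
    simp only [s, dif_pos h]
    exact (add_left_cancel h.choose_spec).symm
  refine ⟨fun x => if x < omegaPow d then f x else g (s x), fun x hx y hy hxy => ?_,
    fun x hx => ?_⟩
  · by_cases hyd : y < omegaPow d
    · simp only [if_pos hyd, if_pos (hxy.trans hyd)]
      exact hf (hxy.trans hyd) hyd hxy
    · obtain ⟨r, hr, rfl⟩ := key y hy hyd
      by_cases hxd : x < omegaPow d
      · simp only [if_neg hyd, if_pos hxd, hs]
        exact (hgb r hr).2.trans_lt (hfb x hxd).1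
      · obtain ⟨r', hr', rfl⟩ := key x hx hxd
        simp only [if_neg hyd, if_neg hxd, hs]
        exact hg hr' hr (lt_of_add_lt_add_left hxy)
  · by_cases hxd : x < omegaPow d
    · simp only [if_pos hxd]
      exact ⟨hab.trans_lt (hfb x hxd).1, (hfb x hxd).2⟩
    · obtain ⟨r, hr, rfl⟩ := key x hx hxd
      simp only [if_neg hxd, hs]
      exact ⟨(hgb r hr).1, (hgb r hr).2.trans hb⟩

theorem HasChain.exists_strictAnti [Preorder P] {a b : P} {c : Value} (h : HasChain a b c) :
    ∃ f : Set.Iio (c.toOrdinal : Ordinal.{v}) → P, StrictAnti f ∧ ∀ i, a < f i := by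
  obtain ⟨f, hf, hab⟩ := h
  choose x hxc hx using fun i : Set.Iio (c.toOrdinal : Ordinal.{v}) =>
    Value.exists_toOrdinal_eq i.2
  refine ⟨fun i => f (x i), fun i j hij => hf (hxc i) (hxc j) ?_, fun i => (hab _ (hxc i)).1⟩
  rw [← Value.toOrdinal_strictMono.{v}.lt_iff_lt, hx, hx]
  exact hij

end HasChain

section Bounds

variable {R : Type*} [CommRing R]

/-! ### Upper bounds for the length of a module -/

/-- `LenLE R M c` says that the descending chains of nonzero submodules of `M` have type at
most `c`. -/
def LenLE (R : Type*) (M : Type*) [CommRing R] [AddCommGroup M] [Module R M] (c : Value) : Prop :=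
  RankLE (⊥ : Submodule R M) c

variable {M N : Type*} [AddCommGroup M] [Module R M] [AddCommGroup N] [Module R N]

theorem LenLE.of_injective {c : Value} (h : LenLE R N c) (f : M →ₗ[R] N)
    (hf : Function.Injective f) : LenLE R M c := by
  refine RankLE.comap (Submodule.map f) ((Submodule.map_strictMono_of_injective hf).strictMonoOn _) ?_
  rwa [Submodule.map_bot]

/-- A submodule is sent to its trace on the kernel and its image in the quotient; this map to the
product is strictly monotone. -/
theorem LenLE.of_ker {a b : Value} (f : M →ₗ[R] N) (ha : LenLE R (LinearMap.ker f) a)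
    (hb : LenLE R N b) : LenLE R M (a + b) := by
  have hb' : LenLE R (M ⧸ LinearMap.ker f) b :=
    hb.of_injective ((LinearMap.ker f).liftQ f le_rfl)
      (LinearMap.ker_eq_bot.mp (Submodule.ker_liftQ_eq_bot' _ _ rfl))
  refine RankLE.comap _ ((Submodule.strictMono_comap_prod_map (LinearMap.ker f)).strictMonoOn _) ?_
  have h := RankLE.prod ha hb'
  rwa [Submodule.map_bot, Submodule.comap_bot, Submodule.ker_subtype]

theorem LenLE.of_subsingleton [Subsingleton M] (c : Value) : LenLE R M c := by
  rw [LenLE, rankLE_iff]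
  exact fun y hy => absurd (Subsingleton.elim ⊥ y) hy.ne

theorem LenLE.of_quotients {c : Value}
    (h : ∀ I : Submodule R M, I ≠ ⊥ → ∃ c' < c, LenLE R (M ⧸ I) c') : LenLE R M c := by
  rw [LenLE, rankLE_iff]
  intro I hI
  obtain ⟨c', hc', h'⟩ := h I hI.ne'
  refine ⟨c', hc', RankLE.comap (Submodule.map I.mkQ) ?_ ?_⟩
  · intro J hJ J' hJ' hlt
    refine lt_of_le_of_ne (Submodule.map_mono hlt.le) fun heq => hlt.ne ?_
    have := congrArg (Submodule.comap I.mkQ) heq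
    rwa [Submodule.comap_map_mkQ, Submodule.comap_map_mkQ, sup_eq_right.mpr hJ,
      sup_eq_right.mpr hJ'] at this
  · rwa [Submodule.mkQ_map_self]

end Bounds

theorem LenLE.len_le {R : Type u} {M : Type v} [CommRing R] [AddCommGroup M] [Module R M]
    {c : Value} (h : LenLE R M c) : len R M ≤ c.toOrdinal := by
  refine csSup_le' ?_
  rintro α ⟨f, hf, hne⟩
  exact RankLE.le_toOrdinal h f hf fun i => bot_lt_iff_ne_bot.mpr (hne i)

theorem toOrdinal_le_len {R : Type u} {M : Type v} [CommRing R] [AddCommGroup M] [Module R M]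
    {c : Value} {A : Submodule R M} (h : HasChain ⊥ A c) : c.toOrdinal ≤ len R M := by
  obtain ⟨f, hf, hne⟩ := h.exists_strictAnti
  exact le_csSup (bddAbove_chainTypes R M) ⟨f, hf, fun i => (hne i).ne'⟩

section Noetherian

variable {R : Type u} [CommRing R]

/-- Dévissage along a prime filtration: values below `ω ^ n` are closed under addition. -/
theorem exists_lenLE_of_forall_prime [IsNoetherianRing R] {n : ℕ}
    (hprime : ∀ p : PrimeSpectrum R, Order.coheight p < n →
      ∃ c < omegaPow n, LenLE R (R ⧸ p.asIdeal) c)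
    (M : Type v) [AddCommGroup M] [Module R M] [Module.Finite R M]
    (hM : ∀ p : PrimeSpectrum R, Module.annihilator R M ≤ p.asIdeal → Order.coheight p < n) :
    ∃ c < omegaPow n, LenLE R M c := by
  revert hM
  refine IsNoetherianRing.induction_on_isQuotientEquivQuotientPrime R (M := M) inferInstance
    (motive := fun N _ _ _ => (∀ p : PrimeSpectrum R, Module.annihilator R N ≤ p.asIdeal →
      Order.coheight p < n) → ∃ c < omegaPow n, LenLE R N c) ?_ ?_ ?_
  · intro N _ _ _ _ _
    exact ⟨0, omegaPow_pos n, LenLE.of_subsingleton 0⟩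
  · intro N _ _ _ p e h
    obtain ⟨c, hc, h'⟩ := hprime p (h p (by rw [e.annihilator_eq, Ideal.annihilator_quotient]))
    exact ⟨c, hc, h'.of_injective e.toLinearMap e.injective⟩
  · intro N₁ _ _ _ N₂ _ _ _ N₃ _ _ _ f g hf hg hfg h₁ h₃ h
    obtain ⟨a, ha, h₁⟩ := h₁ fun p hp => h p ((f.annihilator_le_of_injective hf).trans hp)
    obtain ⟨b, hb, h₃⟩ := h₃ fun p hp => h p ((g.annihilator_le_of_surjective hg).trans hp)
    refine ⟨a + b, add_lt_omegaPow ha hb, LenLE.of_ker g ?_ h₃⟩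
    let e : LinearMap.ker g ≃ₗ[R] N₁ :=
      (LinearEquiv.ofEq _ _ (LinearMap.exact_iff.mp hfg)).trans (LinearEquiv.ofInjective f hf).symm
    exact h₁.of_injective e.toLinearMap e.injective

/-- A proper quotient of the domain `R/p` is supported on primes strictly above `p`, so by induction
its bound is below `ω ^ n`. -/
theorem lenLE_quotient_prime [IsNoetherianRing R] (n : ℕ) (p : PrimeSpectrum R)
    (hp : Order.coheight p ≤ n) : LenLE R (R ⧸ p.asIdeal) (omegaPow n) := by
  induction n using Nat.strong_induction_on generalizing p with
  | _ n ih =>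
    refine LenLE.of_quotients fun I hI => exists_lenLE_of_forall_prime ?_ _ ?_
    · intro q hq
      obtain ⟨m, hm⟩ := ENat.ne_top_iff_exists.mp hq.ne_top
      have hmn : m < n := by
        rw [← hm] at hq
        exact_mod_cast hq
      exact ⟨_, omegaPow_strictMono hmn, ih m hmn q hm.ge⟩
    · intro q hq
      refine Order.coheight_le_coe_iff.mp hp q ?_
      obtain ⟨x, hxI, hx⟩ := Submodule.exists_mem_ne_zero_of_ne_bot hI
      obtain ⟨r, rfl⟩ := Ideal.Quotient.mk_surjective x
      refine lt_of_le_of_ne (fun a ha => hq ?_) ?_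
      · rw [Module.mem_annihilator]
        intro m
        induction m using Submodule.Quotient.induction_on with
        | _ m =>
          obtain ⟨s, rfl⟩ := Ideal.Quotient.mk_surjective m
          rw [← Submodule.Quotient.mk_smul]
          have : a • (Ideal.Quotient.mk p.asIdeal s) = 0 := by
            rw [Algebra.smul_def, Ideal.Quotient.algebraMap_eq, ← map_mul,
              Ideal.Quotient.eq_zero_iff_mem]
            exact p.asIdeal.mul_mem_right _ ha
          rw [this, Submodule.Quotient.mk_zero]
      · rintro rfl
        refine hx (Ideal.Quotient.eq_zero_iff_mem.mpr (hq ?_))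
        rw [Module.mem_annihilator]
        intro m
        induction m using Submodule.Quotient.induction_on with
        | _ m =>
          obtain ⟨s, rfl⟩ := Ideal.Quotient.mk_surjective m
          rw [← Submodule.Quotient.mk_smul, Submodule.Quotient.mk_eq_zero]
          have : r • (Ideal.Quotient.mk p.asIdeal s) = s • Ideal.Quotient.mk p.asIdeal r := by
            simp only [Algebra.smul_def, Ideal.Quotient.algebraMap_eq, mul_comm]
          rw [this]
          exact I.smul_mem s hxI

theorem exists_lenLE_lt_omegaPow [IsNoetherianRing R] {n : ℕ}
    (M : Type v) [AddCommGroup M] [Module R M] [Module.Finite R M]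
    (hM : ∀ p : PrimeSpectrum R, Module.annihilator R M ≤ p.asIdeal → Order.coheight p < n) :
    ∃ c < omegaPow n, LenLE R M c := by
  refine exists_lenLE_of_forall_prime (fun q hq => ?_) M hM
  obtain ⟨m, hm⟩ := ENat.ne_top_iff_exists.mp hq.ne_top
  refine ⟨_, omegaPow_strictMono (a := m) ?_, lenLE_quotient_prime m q hm.ge⟩
  rw [← hm] at hq
  exact_mod_cast hq

/-! ### Lower bounds -/

theorem sup_span_pow_mul_lt {p I J : Ideal R} (hp : p.IsPrime) {x : R} (hx : x ∉ p) (n : ℕ)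
    (hI : p ≤ I) (hIJ : I < J) : p ⊔ Ideal.span {x ^ n} * I < p ⊔ Ideal.span {x ^ n} * J := by
  obtain ⟨y, hyJ, hyI⟩ := SetLike.exists_of_lt hIJ
  refine lt_of_le_of_ne (sup_le_sup_left (Ideal.mul_mono_right hIJ.le) _) fun heq => hyI ?_
  have hy : x ^ n * y ∈ p ⊔ Ideal.span {x ^ n} * I := by
    rw [heq]
    exact Ideal.mem_sup_right (Ideal.mul_mem_mul (Ideal.mem_span_singleton_self _) hyJ)
  obtain ⟨a, ha, b, hb, hab⟩ := Submodule.mem_sup.mp hy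
  obtain ⟨z, hz, rfl⟩ := Ideal.mem_span_singleton_mul.mp hb
  have h1 : x ^ n * (y - z) ∈ p := by
    rw [mul_sub, ← hab, add_sub_cancel_right]
    exact ha
  have h2 : y - z ∈ p :=
    (hp.mem_or_mem h1).resolve_left fun h => hx (hp.mem_of_pow_mem n h)
  simpa using I.add_mem (hI h2) hz

/-- With `x ∈ q \ p`, the ideals `p + x ^ n I`, for `I` in the given chain, form the `n`-th of `ω`
blocks of type `ω ^ d`. Since `x ∈ q`, later blocks lie inside `p + x ^ n q`, strictly below block
`n`. -/
theorem HasChain.of_prime_lt {p q : Ideal R} (hp : p.IsPrime) (hpq : p < q) {d : ℕ}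
    (h : HasChain q ⊤ (omegaPow d)) : HasChain p ⊤ (omegaPow (d + 1)) := by
  obtain ⟨f, hf, hq⟩ := h
  obtain ⟨x, hxq, hxp⟩ := SetLike.exists_of_lt hpq
  choose n r hr hnr using fun c : Set.Iio (omegaPow (d + 1)) => exists_eq_nsmul_add c.2
  let g : Set.Iio (omegaPow (d + 1)) → Ideal R := fun c => p ⊔ Ideal.span {x ^ n c} * f (r c)
  have hlow : ∀ c, p ⊔ Ideal.span {x ^ n c} * q < g c := fun c =>
    sup_span_pow_mul_lt hp hxp (n c) hpq.le (hq _ (hr c)).1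
  have hg : StrictAnti g := by
    intro c c' hcc
    have h1 : (c : Value) < c' := hcc
    rw [hnr c, hnr c'] at h1
    rcases lex_of_nsmul_add_lt (hr c') h1 with h1 | ⟨h1, h2⟩
    · refine lt_of_le_of_lt ?_ (hlow c)
      obtain ⟨k, hk⟩ := Nat.exists_eq_add_of_lt h1
      refine sup_le_sup_left (Ideal.mul_le_left.trans ?_) _
      rw [Ideal.span_singleton_le_iff_mem, hk, add_assoc, pow_add]
      exact Ideal.mul_mem_mul (Ideal.mem_span_singleton_self _)
        (q.pow_mem_of_mem hxq _ k.succ_pos)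
    · simp only [g, ← h1]
      exact sup_span_pow_mul_lt hp hxp (n c) (hpq.le.trans (hq _ (hr c')).1.le)
        (hf (hr c) (hr c') h2)
  classical
  refine ⟨fun c => if h : c < omegaPow (d + 1) then g ⟨c, h⟩ else ⊤, fun c hc c' hc' hcc => ?_,
    fun c hc => ⟨?_, le_top⟩⟩
  · rw [Set.mem_Iio] at hc hc'
    simp only [dif_pos hc, dif_pos hc']
    exact hg hcc
  · simp only [dif_pos hc]
    exact le_sup_left.trans_lt (hlow _)

theorem hasChain_prime (d : ℕ) (p : PrimeSpectrum R) (hp : Order.coheight p = d) :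
    HasChain p.asIdeal ⊤ (omegaPow d) := by
  induction d generalizing p with
  | zero => exact hasChain_omegaPow_zero (lt_top_iff_ne_top.mpr p.2.ne_top)
  | succ d ih =>
    obtain ⟨-, ⟨q, hpq, hq⟩, -⟩ := Order.coheight_eq_coe_add_one_iff.mp (by exact_mod_cast hp)
    exact HasChain.of_prime_lt p.2 hpq (ih q hq)

/-- Here `p = (A : m)`, so `I ↦ A + I m` is strictly monotone on ideals containing `p`. -/
theorem HasChain.of_colon {M : Type*} [AddCommGroup M] [Module R M] {p : Ideal R}
    {A : Submodule R M} {m : M} (hA : ∀ r, r • m ∈ A ↔ r ∈ p) {c : Value}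
    (h : HasChain p ⊤ c) : HasChain A (A ⊔ Submodule.span R {m}) c := by
  have hm := h.map (fun I => A ⊔ Submodule.map (LinearMap.toSpanSingleton R M m) I) ?_
  · have h1 : A ⊔ Submodule.map (LinearMap.toSpanSingleton R M m) p = A := by
      rw [sup_eq_left]
      rintro _ ⟨r, hr, rfl⟩
      exact (hA r).mpr hr
    rwa [h1, Submodule.map_top, LinearMap.range_toSpanSingleton] at hm
  · intro I hI J hJ hIJ
    obtain ⟨y, hyJ, hyI⟩ := SetLike.exists_of_lt hIJ
    refine lt_of_le_of_ne (sup_le_sup_left (Submodule.map_mono hIJ.le) _) fun heq => hyI ?_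
    have hy : y • m ∈ A ⊔ Submodule.map (LinearMap.toSpanSingleton R M m) I := by
      rw [show A ⊔ Submodule.map (LinearMap.toSpanSingleton R M m) I = _ from heq]
      exact Submodule.mem_sup_right ⟨y, hyJ, rfl⟩
    obtain ⟨a, ha, _, ⟨z, hz, rfl⟩, hab⟩ := Submodule.mem_sup.mp hy
    have h1 : (y - z) • m ∈ A := by
      rw [sub_smul, ← hab]
      simpa using ha
    simpa using I.add_mem (hI.1 ((hA _).mp h1)) hz

end Noetherian

/-! ### Comparison of lengths and modules of length at most one -/

section Length

variable {R : Type u} {M N : Type v} [CommRing R] [AddCommGroup M] [Module R M] [AddCommGroup N]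
  [Module R N]

theorem chainTypes_subset_of_injective (f : M →ₗ[R] N) (hf : Function.Injective f) :
    chainTypes R M ⊆ chainTypes R N := by
  rintro α ⟨g, hg, hne⟩
  refine ⟨fun i => (g i).map f, fun i j hij => Submodule.map_strictMono_of_injective hf (hg hij),
    fun i h => hne i ?_⟩
  exact Submodule.map_injective_of_injective hf (h.trans (Submodule.map_bot f).symm)

theorem len_top : len R (⊤ : Submodule R M) = len R M := by
  refine congrArg sSup (Set.Subset.antisymm ?_ ?_)
  · exact chainTypes_subset_of_injective _ Submodule.topEquiv.injective
  · exact chainTypes_subset_of_injective _ (Submodule.topEquiv (R := R) (M := M)).symm.injective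

theorem len_le_finLen (h : len R M < Ordinal.omega0) : len R M ≤ finLen R M :=
  le_csSup ⟨Ordinal.omega0, by rintro α ⟨-, -, hα⟩; exact hα.le⟩ ⟨⊤, len_top, h⟩

theorem eq_top_of_len_le_one (h : len R M ≤ 1) {N : Submodule R M} (hN : N ≠ ⊥) : N = ⊤ := by
  by_contra htop
  have hc : HasChain (⊥ : Submodule R M) ⊤ (omegaPow 0 + omegaPow 0) :=
    (hasChain_omegaPow_zero (lt_top_iff_ne_top.mpr htop)).trans
      (hasChain_omegaPow_zero (bot_lt_iff_ne_bot.mpr hN)) bot_le le_top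
      (omegaPow_strictMono Nat.zero_lt_one)
  have h0 : (0 : Ordinal.{v}) < (omegaPow 0).toOrdinal :=
    bot_le.trans_lt (Value.toOrdinal_strictMono (omegaPow_pos 0))
  have h1 : (1 : Ordinal.{v}) < (omegaPow 0 + omegaPow 0).toOrdinal :=
    (Order.one_le_iff_pos.mpr h0).trans_lt
      (Value.toOrdinal_strictMono (lt_add_of_pos_right _ (omegaPow_pos 0)))
  exact (h1.trans_le ((toOrdinal_le_len hc).trans h)).false

end Length

/-! ### Localization at associated primes -/

section Component

variable {R : Type u} [CommRing R] (M : Type v) [AddCommGroup M] [Module R M]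

/-- The elements of `M` that vanish in the localization at `p`. -/
noncomputable def vanishingAt (p : Ideal R) [p.IsPrime] : Submodule R M :=
  LinearMap.ker (LocalizedModule.mkLinearMap p.primeCompl M)

variable {M}

theorem mem_vanishingAt {p : Ideal R} [p.IsPrime] {m : M} :
    m ∈ vanishingAt M p ↔ ∃ s, s ∉ p ∧ s • m = 0 :=
  LocalizedModule.mem_ker_mkLinearMap_iff

theorem eq_zero_of_forall_mem_vanishingAt [IsNoetherianRing R] {m : M}
    (h : ∀ p : PrimeSpectrum R, p.asIdeal ∈ associatedPrimes R M → m ∈ vanishingAt M p.asIdeal) :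
    m = 0 := by
  by_contra hm
  obtain ⟨p, hp, hle⟩ := exists_le_isAssociatedPrime_of_isNoetherianRing R m hm
  obtain ⟨P, rfl⟩ : ∃ P : PrimeSpectrum R, P.asIdeal = p := ⟨⟨p, hp.isPrime⟩, rfl⟩
  obtain ⟨s, hs, hsm⟩ := mem_vanishingAt.mp (h P hp)
  exact hs (hle (by simpa [Submodule.mem_colon_singleton] using hsm))

/-- Minimal primes over the annihilator are associated, so no prime of the support lies strictly
below `p`. -/
theorem eq_of_annihilator_le_of_le [IsNoetherianRing R] [Module.Finite R M] {p q : Ideal R}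
    (hp : Minimal (· ∈ associatedPrimes R M) p) (hq : q.IsPrime)
    (hMq : Module.annihilator R M ≤ q) (hqp : q ≤ p) : q = p := by
  obtain ⟨q', hq', hle⟩ := Ideal.exists_minimalPrimes_le hMq
  have hmem := Module.associatedPrimes.minimalPrimes_annihilator_subset_associatedPrimes R M hq'
  exact le_antisymm hqp ((hp.2 hmem (hle.trans hqp)).trans hle)

/-- Primes in the support of `M_p` contract to `p`, hence are maximal; the dimension bound with `n =
1` applies. -/
theorem len_localizedModule_lt_omega0 [IsNoetherianRing R] [Module.Finite R M] {p : Ideal R}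
    [p.IsPrime] (hp : Minimal (· ∈ associatedPrimes R M) p) :
    len (Localization.AtPrime p) (LocalizedModule p.primeCompl M) < Ordinal.omega0 := by
  obtain ⟨c, hc, h⟩ := exists_lenLE_lt_omegaPow (R := Localization.AtPrime p) (n := 1)
    (LocalizedModule p.primeCompl M) fun Q hQ => by
      have hQp : Q.asIdeal.comap (algebraMap R (Localization.AtPrime p)) = p := by
        refine eq_of_annihilator_le_of_le hp (Q.2.comap _) (fun a ha => hQ ?_) ?_
        · rw [Module.mem_annihilator] at ha ⊢
          intro m
          induction m using LocalizedModule.induction_on with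
          | _ m s =>
            rw [algebraMap_smul, LocalizedModule.smul'_mk, ha, LocalizedModule.zero_mk]
        · exact (Ideal.comap_mono (IsLocalRing.le_maximalIdeal Q.2.ne_top)).trans
            (IsLocalization.AtPrime.under_maximalIdeal (Localization.AtPrime p) p).le
      have hmax : IsMax Q := by
        intro Q' hQ'
        have h1 : Q'.asIdeal ≤ IsLocalRing.maximalIdeal (Localization.AtPrime p) :=
          IsLocalRing.le_maximalIdeal Q'.2.ne_top
        refine PrimeSpectrum.asIdeal_le_asIdeal _ _ |>.mp (h1.trans ?_)
        rw [← Localization.AtPrime.map_eq_maximalIdeal, Ideal.map_le_iff_le_comap, hQp]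
      rw [Order.coheight_eq_zero.mpr hmax]
      exact zero_lt_one
  exact h.len_le.trans_lt (Value.toOrdinal_lt_omega0 hc)

theorem exists_smul_eq_smul_of_len_le_one {p : Ideal R} [p.IsPrime]
    (h : len (Localization.AtPrime p) (LocalizedModule p.primeCompl M) ≤ 1) {x : M}
    (hx : x ∉ vanishingAt M p) (y : M) : ∃ s, s ∉ p ∧ ∃ r : R, s • y = r • x := by
  have htop : Submodule.span (Localization.AtPrime p) {LocalizedModule.mk x (1 : p.primeCompl)} = ⊤ :=
    eq_top_of_len_le_one h (by rw [Ne, Submodule.span_singleton_eq_bot]; exact hx)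
  have hy : LocalizedModule.mk y (1 : p.primeCompl) ∈
      Submodule.span (Localization.AtPrime p) {LocalizedModule.mk x (1 : p.primeCompl)} :=
    htop ▸ Submodule.mem_top
  obtain ⟨a, ha⟩ := Submodule.mem_span_singleton.mp hy
  induction a using Localization.induction_on with | _ rs
  obtain ⟨r, s⟩ := rs
  rw [LocalizedModule.mk_smul_mk, LocalizedModule.mk_eq] at ha
  obtain ⟨u, hu⟩ := ha
  refine ⟨u * s, (u * s).2, u * r, ?_⟩
  simpa [Submonoid.smul_def, mul_smul] using hu.symm

/-- Take `x` with annihilator `p`. Some `t ∉ p` carries all of `M` into `R x ≅ R/p`, and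
multiplication by `t` is the map: its kernel is right because `R/p` has no torsion outside `p`. -/
theorem exists_linearMap_ker_eq_vanishingAt [IsNoetherianRing R] [Module.Finite R M] {p : Ideal R}
    [p.IsPrime] (hp : p ∈ associatedPrimes R M)
    (h : len (Localization.AtPrime p) (LocalizedModule p.primeCompl M) ≤ 1) :
    ∃ f : M →ₗ[R] R ⧸ p, LinearMap.ker f = vanishingAt M p := by
  obtain ⟨-, x, hpx⟩ := isAssociatedPrime_iff.mp hp
  have hann : ∀ r : R, r • x = 0 ↔ r ∈ p := fun r => by
    rw [hpx, Submodule.mem_colon_singleton, Submodule.mem_bot]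
  have hx : x ∉ vanishingAt M p := fun hx => by
    obtain ⟨s, hs, hsx⟩ := mem_vanishingAt.mp hx
    exact hs ((hann s).mp hsx)
  choose s hs r hr using exists_smul_eq_smul_of_len_le_one h hx
  obtain ⟨G, hG⟩ := (Module.Finite.fg_top : (⊤ : Submodule R M).FG)
  -- A common denominator for a finite set of generators.
  let t : R := ∏ y ∈ G, s y
  have ht : t ∉ p := Submonoid.prod_mem p.primeCompl fun y _ => hs y
  let τ := LinearMap.toSpanSingleton R M x
  have hker : LinearMap.ker τ = p := Ideal.ext fun a => hann a
  have htM : ∀ y : M, (t • LinearMap.id (R := R) (M := M)) y ∈ LinearMap.range τ := by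
    have : Submodule.span R (G : Set M) ≤ (LinearMap.range τ).comap (t • LinearMap.id) := by
      rw [Submodule.span_le]
      intro y hy
      obtain ⟨b, hb⟩ := Finset.dvd_prod_of_mem s hy
      refine ⟨b * r y, ?_⟩
      change (b * r y) • x = t • y
      rw [mul_smul, ← hr, smul_smul, mul_comm]
      exact congrArg (· • y) hb.symm
    rw [hG] at this
    exact fun y => this Submodule.mem_top
  let e : LinearMap.range τ ≃ₗ[R] R ⧸ p :=
    τ.quotKerEquivRange.symm.trans (Submodule.quotEquivOfEq _ _ hker)
  refine ⟨e.toLinearMap ∘ₗ LinearMap.codRestrict _ _ htM, ?_⟩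
  rw [LinearEquiv.ker_comp, LinearMap.ker_codRestrict]
  ext y
  rw [mem_vanishingAt]
  change t • y = 0 ↔ _
  refine ⟨fun hy => ⟨t, ht, hy⟩, ?_⟩
  rintro ⟨a, ha, hay⟩
  obtain ⟨b, hb⟩ := htM y
  change b • x = t • y at hb
  rw [← hb, hann]
  refine (Ideal.IsPrime.mem_or_mem ‹_› ((hann (a * b)).mp ?_)).resolve_left ha
  rw [mul_smul, hb, smul_comm, hay, smul_zero]

end Component

/-! ### Coordinates in the domains `R/p` and dual families -/

section Coordinates

variable {R : Type u} [CommRing R] {M : Type v} [AddCommGroup M] [Module R M]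

theorem lenLE_of_separating [IsNoetherianRing R] {d : PrimeSpectrum R → ℕ}
    (hd : ∀ p, Order.coheight p = d p) (T : Finset (PrimeSpectrum R))
    (f : ∀ p : PrimeSpectrum R, M →ₗ[R] R ⧸ p.asIdeal)
    (hf : ∀ m, (∀ p ∈ T, f p m = 0) → m = 0) : LenLE R M (∑ p ∈ T, omegaPow (d p)) := by
  classical
  induction T using Finset.induction_on generalizing M with
  | empty =>
    have : Subsingleton M := ⟨fun a b => by rw [hf a (by simp), hf b (by simp)]⟩
    exact LenLE.of_subsingleton _
  | insert a T ha ih =>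
    rw [Finset.sum_insert ha, add_comm]
    refine LenLE.of_ker (f a) ?_ (lenLE_quotient_prime (d a) a (hd a).le)
    refine ih (fun p => f p ∘ₗ (LinearMap.ker (f a)).subtype) fun m hm => Subtype.ext (hf m ?_)
    intro p hp
    rcases Finset.mem_insert.mp hp with rfl | hp
    · exact m.2
    · exact hm p hp

theorem smul_quotient_eq_zero_iff {p : PrimeSpectrum R} {r : R} {x : R ⧸ p.asIdeal} :
    r • x = 0 ↔ r ∈ p.asIdeal ∨ x = 0 := by
  rw [Algebra.smul_def, mul_eq_zero, Ideal.Quotient.algebraMap_eq, Ideal.Quotient.eq_zero_iff_mem]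

/-- Primes are added in order of increasing dimension, so that each new, largest power of `ω` is
placed on top. The colon ideal of `n a` modulo the earlier span is exactly `a`. -/
theorem hasChain_span_of_dual [IsNoetherianRing R] {d : PrimeSpectrum R → ℕ}
    (hd : ∀ p, Order.coheight p = d p) {S : Finset (PrimeSpectrum R)}
    (f : ∀ p : PrimeSpectrum R, M →ₗ[R] R ⧸ p.asIdeal)
    (hf : ∀ m, (∀ p ∈ S, f p m = 0) → m = 0) (n : PrimeSpectrum R → M)
    (hn : ∀ p ∈ S, f p (n p) ≠ 0) (hn' : ∀ p ∈ S, ∀ q ∈ S, q ≠ p → f q (n p) = 0)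
    (T : Finset (PrimeSpectrum R)) (hT : T ⊆ S) :
    HasChain ⊥ (Submodule.span R (n '' T)) (∑ p ∈ T, omegaPow (d p)) := by
  classical
  induction T using Finset.induction_on_max_value d with
  | empty => exact hasChain_zero _ _
  | insert a T ha hmax ih =>
    obtain ⟨haS, hTS⟩ := Finset.insert_subset_iff.mp hT
    rw [Finset.sum_insert ha, Finset.coe_insert, Set.image_insert_eq, Set.insert_eq,
      Submodule.span_union, sup_comm]
    refine HasChain.trans ?_ (ih hTS) bot_le le_sup_left
      (sum_lt_omegaPow _ _ fun p hp => omegaPow_strictMono (Nat.lt_succ_of_le (hmax p hp)))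
    refine HasChain.of_colon (fun r => ⟨fun hr => ?_, fun hr => ?_⟩) (hasChain_prime (d a) a (hd a))
    · have hle : Submodule.span R (n '' T) ≤ LinearMap.ker (f a) := by
        rw [Submodule.span_le]
        rintro _ ⟨p, hp, rfl⟩
        exact hn' p (hTS hp) a haS fun h => ha (h ▸ hp)
      have h0 : f a (r • n a) = 0 := hle hr
      rw [map_smul] at h0
      exact (smul_quotient_eq_zero_iff.mp h0).resolve_right (hn a haS)
    · have h0 : r • n a = 0 := hf _ fun q hq => by
        rw [map_smul, smul_quotient_eq_zero_iff]
        rcases eq_or_ne q a with rfl | hqa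
        · exact Or.inl hr
        · exact Or.inr (hn' a haS q hq hqa)
      rw [h0]
      exact Submodule.zero_mem _

/-- By incomparability some product of elements of the other primes avoids `p`; multiplying by it
kills every coordinate but the one at `p`. -/
theorem exists_dual_family {S : Finset (PrimeSpectrum R)}
    (hS : ∀ p ∈ S, ∀ q ∈ S, p ≤ q → p = q)
    (f : ∀ p : PrimeSpectrum R, M →ₗ[R] R ⧸ p.asIdeal) (N : Submodule R M)
    (hN : ∀ p ∈ S, ∃ x ∈ N, f p x ≠ 0) :
    ∃ n : PrimeSpectrum R → M, (∀ p, n p ∈ N) ∧ (∀ p ∈ S, f p (n p) ≠ 0) ∧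
      ∀ p ∈ S, ∀ q ∈ S, q ≠ p → f q (n p) = 0 := by
  classical
  have key : ∀ p, ∃ x ∈ N, p ∈ S → f p x ≠ 0 ∧ ∀ q ∈ S, q ≠ p → f q x = 0 := by
    intro p
    by_cases hp : p ∈ S
    swap
    · exact ⟨0, N.zero_mem, fun h => absurd h hp⟩
    obtain ⟨x, hxN, hx⟩ := hN p hp
    have hsep : ∀ q, ∃ s : R, s ∉ p.asIdeal ∧ (q ∈ S → q ≠ p → s ∈ q.asIdeal) := by
      intro q
      by_cases hq : q ∈ S ∧ q ≠ p
      · have hle : ¬ q.asIdeal ≤ p.asIdeal := fun h => hq.2 (hS q hq.1 p hp h)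
        obtain ⟨s, hs, hsp⟩ := SetLike.not_le_iff_exists.mp hle
        exact ⟨s, hsp, fun _ _ => hs⟩
      · exact ⟨1, p.2.one_notMem, fun h1 h2 => absurd ⟨h1, h2⟩ hq⟩
    choose s hsp hsq using hsep
    refine ⟨(∏ q ∈ S, s q) • x, N.smul_mem _ hxN, fun _ => ⟨?_, fun q hq hqp => ?_⟩⟩
    · rw [map_smul, Ne, smul_quotient_eq_zero_iff]
      exact not_or.mpr ⟨Submonoid.prod_mem p.asIdeal.primeCompl fun q _ => hsp q, hx⟩
    · rw [map_smul, smul_quotient_eq_zero_iff]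
      exact Or.inl (Ideal.mem_of_dvd _ (Finset.dvd_prod_of_mem s hq) (hsq q hq hqp))
  choose n hnN hn using key
  exact ⟨n, hnN, fun p hp => (hn p hp).1, fun p hp => (hn p hp).2⟩

/-- Each `n p` is killed by `p`, so `m ↦ ∑ f_p(m) n_p` makes sense; applying `f p` to the sum
isolates the `p`-th term and recovers `f p m = 0` from a zero sum. -/
theorem exists_injective_of_dual_family {S : Finset (PrimeSpectrum R)}
    (f : ∀ p : PrimeSpectrum R, M →ₗ[R] R ⧸ p.asIdeal)
    (hf : ∀ m, (∀ p ∈ S, f p m = 0) → m = 0) {N : Submodule R M} (n : PrimeSpectrum R → M)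
    (hnN : ∀ p, n p ∈ N) (hn : ∀ p ∈ S, f p (n p) ≠ 0)
    (hn' : ∀ p ∈ S, ∀ q ∈ S, q ≠ p → f q (n p) = 0) :
    ∃ g : M →ₗ[R] N, Function.Injective g := by
  classical
  have hann : ∀ p : S, p.1.asIdeal ≤
      LinearMap.ker (LinearMap.toSpanSingleton R N ⟨n p, hnN p⟩) := by
    intro p r hr
    refine Subtype.ext (hf (r • n p) fun q hq => ?_)
    rw [map_smul, smul_quotient_eq_zero_iff]
    rcases eq_or_ne q p.1 with rfl | hqp
    · exact Or.inl hr
    · exact Or.inr (hn' p p.2 q hq hqp)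
  let g : M →ₗ[R] N := ∑ p : S, (p.1.asIdeal.liftQ _ (hann p)) ∘ₗ f p
  refine ⟨g, (injective_iff_map_eq_zero g).mpr fun m hm => hf m fun p hp => ?_⟩
  have hterm : ∀ q : S, ∃ r : R, Ideal.Quotient.mk q.1.asIdeal r = f q m ∧
      ((q.1.asIdeal.liftQ _ (hann q)) (f q m) : M) = r • n q := by
    intro q
    obtain ⟨r, hr⟩ := Ideal.Quotient.mk_surjective (f q m)
    refine ⟨r, hr, ?_⟩
    rw [← hr]
    rfl
  choose r hr hg using hterm
  have h0 : f p (∑ q : S, r q • n q) = 0 := by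
    have h1 : ((g m : N) : M) = ∑ q : S, r q • n q := by
      simp only [g, LinearMap.sum_apply, AddSubmonoidClass.coe_finsetSum, LinearMap.comp_apply, hg]
    rw [← h1, hm, Submodule.coe_zero, map_zero]
  rw [map_sum, Finset.sum_eq_single ⟨p, hp⟩, map_smul, smul_quotient_eq_zero_iff] at h0
  · rw [← hr ⟨p, hp⟩, Ideal.Quotient.eq_zero_iff_mem]
    exact h0.resolve_right (hn p hp)
  · intro q _ hq
    rw [map_smul, hn' q q.2 p hp fun h => hq (Subtype.ext h.symm), smul_zero]
  · simp

theorem exists_apply_ne_zero_of_isOpenSubmodule [IsNoetherianRing R] {d : PrimeSpectrum R → ℕ}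
    (hd : ∀ p, Order.coheight p = d p) {S : Finset (PrimeSpectrum R)}
    (f : ∀ p : PrimeSpectrum R, M →ₗ[R] R ⧸ p.asIdeal)
    (hf : ∀ m, (∀ p ∈ S, f p m = 0) → m = 0) (n : PrimeSpectrum R → M)
    (hn : ∀ p ∈ S, f p (n p) ≠ 0) (hn' : ∀ p ∈ S, ∀ q ∈ S, q ≠ p → f q (n p) = 0)
    {N : Submodule R M} (hN : IsOpenSubmodule N) {p : PrimeSpectrum R} (hp : p ∈ S) :
    ∃ x ∈ N, f p x ≠ 0 := by
  classical
  by_contra! h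
  have hupper : LenLE R N (∑ q ∈ S.erase p, omegaPow (d q)) := by
    refine lenLE_of_separating hd _ (fun q => f q ∘ₗ N.subtype) fun m hm => Subtype.ext (hf m ?_)
    intro q hq
    rcases eq_or_ne q p with rfl | hqp
    · exact h m m.2
    · exact hm q (Finset.mem_erase.mpr ⟨hqp, hq⟩)
  have hlower := toOrdinal_le_len (hasChain_span_of_dual hd f hf n hn hn' S subset_rfl)
  have hlt : ∑ q ∈ S.erase p, omegaPow (d q) < ∑ q ∈ S, omegaPow (d q) := by
    rw [← Finset.sum_erase_add _ _ hp]
    exact lt_add_of_pos_right _ (omegaPow_pos _)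
  have := (hupper.len_le.trans_lt (Value.toOrdinal_strictMono hlt)).trans_le hlower
  exact this.ne hN

end Coordinates

end OrdinalLength

theorem corollaryC {R : Type u} [CommRing R] [IsNoetherianRing R] (hR : ringKrullDim R ≠ ⊤)
    {M : Type v} [AddCommGroup M] [Module R M] [Module.Finite R M]
    (hbin : OrdinalLength.IsBinary R M)
    (hemb : ∀ p : Ideal R, ¬ OrdinalLength.IsEmbeddedPrime R M p) :
    OrdinalLength.IsTopCompressible R M := by
  open OrdinalLength in
  have hmin : ∀ p ∈ associatedPrimes R M, Minimal (· ∈ associatedPrimes R M) p := fun p hp =>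
    not_not.mp fun h => hemb p ⟨hp, h⟩
  have hlen : ∀ p : PrimeSpectrum R, p.asIdeal ∈ associatedPrimes R M →
      len (Localization.AtPrime p.asIdeal) (LocalizedModule p.asIdeal.primeCompl M) ≤ 1 := by
    intro p hp
    obtain ⟨B, hB⟩ := hbin
    -- Finite length lets `M_p` itself compete in the supremum defining its coefficient, which is 0
    -- or 1.
    refine (len_le_finLen (len_localizedModule_lt_omega0 (hmin _ hp))).trans ?_
    change fundamentalCycle R M p ≤ 1
    rw [hB]
    exact Set.indicator_apply_le' (fun _ => le_rfl) fun _ => zero_le_one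
  have hcoord : ∀ p : PrimeSpectrum R, ∃ f : M →ₗ[R] R ⧸ p.asIdeal,
      p.asIdeal ∈ associatedPrimes R M → LinearMap.ker f = vanishingAt M p.asIdeal := by
    intro p
    by_cases hp : p.asIdeal ∈ associatedPrimes R M
    · obtain ⟨f, hf⟩ := exists_linearMap_ker_eq_vanishingAt hp (hlen p hp)
      exact ⟨f, fun _ => hf⟩
    · exact ⟨0, fun h => absurd h hp⟩
  choose f hker using hcoord
  have hfin : {p : PrimeSpectrum R | p.asIdeal ∈ associatedPrimes R M}.Finite :=
    (associatedPrimes.finite R M).preimage fun p _ q _ h => PrimeSpectrum.ext h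
  have hS : ∀ p, p ∈ hfin.toFinset ↔ p.asIdeal ∈ associatedPrimes R M := fun p =>
    hfin.mem_toFinset
  have hf : ∀ m, (∀ p ∈ hfin.toFinset, f p m = 0) → m = 0 := fun m hm =>
    eq_zero_of_forall_mem_vanishingAt fun p hp => by
      rw [← hker p hp]
      exact hm p ((hS p).mpr hp)
  have hanti : ∀ p ∈ hfin.toFinset, ∀ q ∈ hfin.toFinset, p ≤ q → p = q := fun p hp q hq hpq =>
    le_antisymm hpq ((hmin _ ((hS q).mp hq)).2 ((hS p).mp hp) hpq)
  have htop : ∀ p ∈ hfin.toFinset, ∃ x ∈ (⊤ : Submodule R M), f p x ≠ 0 := by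
    intro p hp
    by_contra! h
    have hp' := (hS p).mp hp
    obtain ⟨-, x, hx⟩ := isAssociatedPrime_iff.mp hp'
    have h0 : x ∈ vanishingAt M p.asIdeal := by
      rw [← hker p hp']
      exact h x Submodule.mem_top
    obtain ⟨s, hs, hsx⟩ := mem_vanishingAt.mp h0
    refine hs ?_
    rw [hx, Submodule.mem_colon_singleton, hsx]
    exact Submodule.zero_mem _
  -- Finite Krull dimension makes every exponent `dim R/p` a natural number.
  have hd : ∀ p : PrimeSpectrum R, Order.coheight p = (Order.coheight p).toNat := by
    intro p
    refine (ENat.natCast_toNat fun h => hR (top_le_iff.mp ?_)).symm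
    have := Order.coheight_le_krullDim p
    rwa [h] at this
  -- This family in `M` serves the lower bound on `len M`; the one in `N` below gives the embedding.
  obtain ⟨m, -, hm, hm'⟩ := exists_dual_family hanti f ⊤ htop
  intro N hN
  obtain ⟨n, hnN, hn, hn'⟩ := exists_dual_family hanti f N fun p hp =>
    exists_apply_ne_zero_of_isOpenSubmodule hd f hf m hm hm' hN hp
  exact exists_injective_of_dual_family f hf n hnN hn hn'
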